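/- **Setting.** All Hilbert spaces are finite dimensional and all C*-algebras are finite dimensional and nonzero. Every Hilbert space $H$ carries a fixed orthonormal basis $\{|i_H\rangle\}$, and every C*-algebra is represented as a block diagonal algebra $\mathcal A=\bigoplus_k B(H_k)\subseteq B(H)$, $H=\bigoplus_k H_k$; $E_{\mathcal A}$ is the trace preserving conditional expectation of $B(H)$ onto $\mathcal A$. Let $\mathcal L(H,K)$ be the real vector space of Hermitian linear maps $B(H)\to B(K)$ (those that map Hermitian operators to Hermitian operators). For $\mathcal A\subseteq B(H)$, $\mathcal B\subseteq B(K)$ let $\mathcal L(\mathcal A,\mathcal B)=\{\phi\in\mathcal L(H,K): E_{\mathcal B}\circ\phi\circ E_{\mathcal A}=\phi\}$, which is identified with the space of real linear maps $\mathcal A_h\to\mathcal B_h$ between the Hermitian parts. For $\phi\in\mathcal L(H,H)$ let $s(\phi)=\sum_{i,j}\langle i_H,\phi(|i_H\rangle\langle j_H|)\,j_H\rangle$; the spaces $\mathcal L(H,K)$ and $\mathcal L(K,H)$ are in duality by $\langle\phi,\psi\rangle=s(\phi\circ\psi)\in\mathbb R$. A *proper cone* is a closed convex cone that is pointed and generating.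 Let $Pos(H,K)$ be the cone of positive maps, $CP(H,K)$ the cone of completely positive maps, and $EB(H,K)$ the cone of maps $a\mapsto\sum_i \mathrm{Tr}(F_ia)\rho_i$ (finite sums, $F_i\in B(H)^+$, $\rho_i\in B(K)^+$). An *admissible family* $\mathcal P$ consists of a proper cone $\mathcal P(H,K)\subset\mathcal L(H,K)$ for every pair $H,K$, such that $EB\subseteq\mathcal P\subseteq Pos$, $\mathcal P\circ\mathcal P\subseteq\mathcal P$ and $CP\circ\mathcal P\circ CP\subseteq\mathcal P$. The dual family is $\mathcal P^*(K,H)=\{\psi\in\mathcal L(K,H):\langle\phi,\psi\rangle\ge0\ \text{for all }\phi\in\mathcal P(H,K)\}$. Put $\mathcal P(\mathcal A,\mathcal B)=\mathcal P(H,K)\cap\mathcal L(\mathcal A,\mathcal B)$ and $\mathcal P^*(\mathcal B,\mathcal A)=\mathcal P^*(K,H)\cap\mathcal L(\mathcal B,\mathcal A)$. The set $\mathcal C(\mathcal A,\mathcal B)$ of *$\mathcal P$-channels* consists of the trace preserving elements of $\mathcal P(\mathcal A,\mathcal B)$. The norm $\|\cdot\|_\diamond$ on $\mathcal L(\mathcal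 A,\mathcal B)$ is the one with unit ball $\{\phi:\ \exists\,\alpha\in\mathcal C(\mathcal A,\mathcal B),\ \alpha-\phi\in\mathcal P(\mathcal A,\mathcal B)\text{ and }\alpha+\phi\in\mathcal P(\mathcal A,\mathcal B)\}$. The norm $\|\cdot\|^\diamond$ on $\mathcal L(\mathcal A,\mathcal B)$ is the dual norm $$\|\phi\|^\diamond=\sup\{\langle\phi,\xi\rangle:\ \xi\in\mathcal L(\mathcal B,\mathcal A),\ \|\xi\|_\diamond\le1\}.$$ Let $\Phi\in\mathcal C(\mathcal A,\mathcal B)$, $\Psi\in\mathcal C(\mathcal A,\mathcal B')$ and $\epsilon\ge0$. For a C*-algebra $\mathcal D$, $\Psi$ is *$(\epsilon,\mathcal D)$-post-processing deficient* with respect to $\Phi$, written $\Psi\succeq_{\epsilon,\mathcal D}\Phi$, if for every $\Gamma\in\mathcal P^*(\mathcal D,\mathcal A)$ and every $\alpha\in\mathcal C(\mathcal B,\mathcal D)$ there is $\alpha'\in\mathcal C(\mathcal B',\mathcal D)$ with $\langle\alpha\circ\Phi,\Gamma\rangle\le\langle\alpha'\circ\Psi,\Gamma\rangle+\epsilon\|\Gamma\|^\diamond$.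 It is *$\epsilon$-post-processing deficient*, written $\Psi\succeq_\epsilon\Phi$, if $\Psi\succeq_{\epsilon,\mathcal D}\Phi$ for all $\mathcal D$. **Theorem (Post-processings).** Let $\mathcal P$ be an admissible family of positive cones, $\Phi\in\mathcal C(\mathcal A,\mathcal B)$, $\Psi\in\mathcal C(\mathcal A,\mathcal B')$ and $\epsilon\ge0$. For every C*-algebra $\mathcal D$ the following are equivalent. 1. $\Psi\succeq_{\epsilon,\mathcal D}\Phi$. 2. For every $\Gamma\in\mathcal P^*(\mathcal D,\mathcal A)$, $\ \|\Phi\circ\Gamma\|^\diamond\le\|\Psi\circ\Gamma\|^\diamond+\epsilon\|\Gamma\|^\diamond$. 3. For every $\Gamma\in\mathcal L(\mathcal D,\mathcal A)$ and every $\alpha\in\mathcal C(\mathcal B,\mathcal D)$ there is $\alpha'\in\mathcal C(\mathcal B',\mathcal D)$ such that $\langle\alpha\circ\Phi,\Gamma\rangle\le\langle\alpha'\circ\Psi,\Gamma\rangle+2\epsilon\|\Gamma\|^\diamond$. 4. For every $\alpha\in\mathcal C(\mathcal B,\mathcal D)$ there is $\alpha'\in\mathcal C(\mathcal B',\mathcal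 D)$ such that $\|\alpha\circ\Phi-\alpha'\circ\Psi\|_\diamond\le2\epsilon$. Moreover, if $id_H\in\mathcal P(H,H)$ for every $H$, then $\Psi\succeq_\epsilon\Phi$ if and only if $\Psi\succeq_{\epsilon,\mathcal B}\Phi$. -/

import Mathlib

namespace PostProcessing

open scoped ComplexOrder

/-- Operators `B(H)` on the Hilbert space `H = ℂ^n` with its fixed orthonormal basis. -/
abbrev Mat (n : ℕ) : Type := Matrix (Fin n) (Fin n) ℂ

/-- Complex linear maps `B(H) → B(K)`, where `H = ℂ^m` and `K = ℂ^n`. -/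
abbrev MatMap (m n : ℕ) : Type := Mat m →ₗ[ℂ] Mat n

/-- The real vector space `L(H,K)` of Hermitian maps, that is, of the linear maps that send
Hermitian operators to Hermitian operators. -/
def Herm (m n : ℕ) : Submodule ℝ (MatMap m n) where
  carrier := {φ | ∀ a : Mat m, a.IsHermitian → (φ a).IsHermitian}
  add_mem' := fun hφ hψ a ha => (hφ a ha).add (hψ a ha)
  zero_mem' := fun _ _ => Matrix.isHermitian_zero
  smul_mem' := fun c φ hφ a ha => by
    have h := hφ a ha
    simp only [Matrix.IsHermitian, LinearMap.smul_apply, Matrix.conjTranspose_smul,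
      star_trivial] at h ⊢
    rw [h]

/-- `s(φ) = ∑_{i,j} ⟨i, φ(|i⟩⟨j|) j⟩`. -/
def sFun {n : ℕ} (φ : MatMap n n) : ℂ :=
  ∑ i : Fin n, ∑ j : Fin n, φ (Matrix.single i j 1) i j

/-- The duality `⟨φ, ψ⟩ = s(φ ∘ ψ)` of `L(H,K)` and `L(K,H)`. On Hermitian maps the value of `s`
is real, so that taking the real part only changes the type. -/
def pairing {m n : ℕ} (φ : MatMap m n) (ψ : MatMap n m) : ℝ :=
  (sFun (φ ∘ₗ ψ)).re

/-! ### Positive, completely positive and entanglement breaking maps -/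

/-- `φ(B(H)^+) ⊆ B(K)^+`. -/
def PreservesPos {ι κ : Type} (φ : Matrix ι ι ℂ → Matrix κ κ ℂ) : Prop :=
  ∀ x : Matrix ι ι ℂ, x.PosSemidef → (φ x).PosSemidef

/-- The map `φ ⊗ id_F`, where `F = ℂ^k`. -/
def tensorId {m n : ℕ} (φ : MatMap m n) (k : ℕ) :
    Matrix (Fin m × Fin k) (Fin m × Fin k) ℂ → Matrix (Fin n × Fin k) (Fin n × Fin k) ℂ :=
  fun X => Matrix.of fun p q => φ (Matrix.of fun i j => X (i, p.2) (j, q.2)) p.1 q.1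

/-- A family of sets of maps, one for each pair of finite dimensional Hilbert spaces. -/
abbrev Family : Type := ∀ m n : ℕ, Set (MatMap m n)

/-- The positive maps. -/
def Pos : Family := fun m n => {φ | φ ∈ Herm m n ∧ PreservesPos φ}

/-- The completely positive maps. -/
def CP : Family := fun m n => {φ | φ ∈ Herm m n ∧ ∀ k : ℕ, PreservesPos (tensorId φ k)}

/-- The entanglement breaking maps `a ↦ ∑_i (Tr F_i a) ρ_i`, with positive `F_i` and `ρ_i`. -/
def EB : Family := fun m n =>
  {φ | ∃ (k : ℕ) (F : Fin k → Mat m) (ρ : Fin k → Mat n),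
    (∀ i, (F i).PosSemidef) ∧ (∀ i, (ρ i).PosSemidef) ∧
      ∀ a : Mat m, φ a = ∑ i, (F i * a).trace • ρ i}

/-! ### Admissible families of cones -/

/-- `Q` is a proper cone in `L(H,K)`: a closed convex cone that is pointed and generating. The
topology of the finite dimensional space `L(H,K)` is that of pointwise convergence. -/
structure IsProperCone {m n : ℕ} (Q : Set (MatMap m n)) : Prop where
  subset_herm : Q ⊆ Herm m n
  zero_mem : (0 : MatMap m n) ∈ Q
  add_mem : ∀ φ ∈ Q, ∀ ψ ∈ Q, φ + ψ ∈ Q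
  smul_mem : ∀ c : ℝ, 0 ≤ c → ∀ φ ∈ Q, c • φ ∈ Q
  closed : IsClosed ((fun (φ : MatMap m n) (a : Mat m) => φ a) '' Q)
  pointed : ∀ φ ∈ Q, -φ ∈ Q → φ = 0
  generating : ∀ φ ∈ Herm m n, ∃ ψ₁ ∈ Q, ∃ ψ₂ ∈ Q, φ = ψ₁ - ψ₂

/-- Admissible families of positive cones. -/
structure IsAdmissible (P : Family) : Prop where
  proper : ∀ m n : ℕ, IsProperCone (P m n)
  eb_subset : ∀ m n : ℕ, EB m n ⊆ P m n
  subset_pos : ∀ m n : ℕ, P m n ⊆ Pos m n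
  comp_mem : ∀ (l m n : ℕ), ∀ φ ∈ P l m, ∀ ψ ∈ P m n, ψ ∘ₗ φ ∈ P l n
  cp_comp_mem : ∀ (k l m n : ℕ), ∀ α ∈ CP k l, ∀ φ ∈ P l m, ∀ β ∈ CP m n, β ∘ₗ φ ∘ₗ α ∈ P k n

/-- The family of dual cones, `P^*(K,H) = P(H,K)^*`. -/
def dualFamily (P : Family) : Family := fun n m =>
  {ψ | ψ ∈ Herm n m ∧ ∀ φ ∈ P m n, 0 ≤ pairing φ ψ}

/-! ### Finite dimensional C*-algebras -/

/-- A nonzero finite dimensional C*-algebra `A = ⨁_k B(H_k) ⊆ B(H)`, where `H = ⨁_k H_k = ℂ^dim`: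
`H_k` is spanned by the basis vectors whose label is `k`, and `A` consists of the block diagonal
operators. -/
structure CAlg where
  dim : ℕ
  dim_pos : 0 < dim
  label : Fin dim → ℕ

namespace CAlg

/-- The block diagonal operators, as a *-subalgebra of `B(H)`. -/
def toStarSubalgebra (A : CAlg) : StarSubalgebra ℂ (Mat A.dim) where
  carrier := {a | ∀ i j, A.label i ≠ A.label j → a i j = 0}
  add_mem' := fun {a b} ha hb i j h => by
    rw [Matrix.add_apply, ha i j h, hb i j h, add_zero]
  mul_mem' := fun {a b} ha hb i j h => by
    rw [Matrix.mul_apply]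
    refine Finset.sum_eq_zero fun k _ => ?_
    by_cases hk : A.label i = A.label k
    · rw [hb k j (fun h' => h (hk.trans h')), mul_zero]
    · rw [ha i k hk, zero_mul]
  algebraMap_mem' := fun r i j h => by
    have hij : i ≠ j := fun h' => h (congrArg A.label h')
    rw [Matrix.algebraMap_matrix_apply, if_neg hij]
  star_mem' := fun {a} ha i j h => by
    rw [Matrix.star_apply, ha j i (Ne.symm h), star_zero]

/-- The trace preserving conditional expectation `E_A` of `B(H)` onto `A`. -/
def condExp (A : CAlg) : MatMap A.dim A.dim where
  toFun := fun a => Matrix.of fun i j => if A.label i = A.label j then a i j else 0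
  map_add' := fun a b => by
    ext i j
    by_cases h : A.label i = A.label j <;> simp [h]
  map_smul' := fun c a => by
    ext i j
    by_cases h : A.label i = A.label j <;> simp [h]

theorem condExp_mem (A : CAlg) (a : Mat A.dim) : A.condExp a ∈ A.toStarSubalgebra := by
  intro i j h
  simp [condExp, h]

theorem trace_condExp_mul (A : CAlg) (a b : Mat A.dim) (hb : b ∈ A.toStarSubalgebra) :
    (A.condExp a * b).trace = (a * b).trace := by
  simp only [Matrix.trace, Matrix.diag_apply, Matrix.mul_apply]
  refine Finset.sum_congr rfl fun i _ => Finset.sum_congr rfl fun j _ => ?_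
  by_cases h : A.label i = A.label j
  · simp [condExp, h]
  · rw [hb j i (Ne.symm h), mul_zero, mul_zero]

end CAlg

/-- `L(A,B)`, where a map `φ : A_h → B_h` is identified with `E_B ∘ φ ∘ E_A ∈ L(H,K)`. -/
def HermAlg (A B : CAlg) : Set (MatMap A.dim B.dim) :=
  {φ | φ ∈ Herm A.dim B.dim ∧ B.condExp ∘ₗ φ ∘ₗ A.condExp = φ}

/-- The cone `P(A,B) = P(H,K) ∩ L(A,B)`. -/
def coneAlg (P : Family) (A B : CAlg) : Set (MatMap A.dim B.dim) :=
  P A.dim B.dim ∩ HermAlg A B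

/-- The `P`-channels `C(A,B)`: the trace preserving elements of `P(A,B)`. -/
def Channel (P : Family) (A B : CAlg) : Set (MatMap A.dim B.dim) :=
  {φ | φ ∈ coneAlg P A B ∧ ∀ a : Mat A.dim, (φ a).trace = a.trace}

/-! ### The diamond norm and its dual -/

/-- The norm `‖·‖_S` of a base section `S` in a space ordered by the cone `Q`: its unit ball is
`{x | ∃ b ∈ S, -b ≤ x ≤ b}`. -/
noncomputable def baseSectionNorm {E : Type} [AddCommGroup E] [Module ℝ E] (Q S : Set E) (x : E) :
    ℝ :=
  gauge {y : E | ∃ b ∈ S, y - -b ∈ Q ∧ b - y ∈ Q} x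

/-- The norm `‖·‖_⋄` on `L(A,B)`: the norm of the base section `C(A,B)`. -/
noncomputable def diamondNorm (P : Family) (A B : CAlg) (φ : MatMap A.dim B.dim) : ℝ :=
  baseSectionNorm (coneAlg P A B) (Channel P A B) φ

/-- The norm `‖·‖^⋄` on `L(A,B)`: the dual of the norm `‖·‖_⋄` on `L(B,A)`. -/
noncomputable def dualDiamondNorm (P : Family) (A B : CAlg) (φ : MatMap A.dim B.dim) : ℝ :=
  sSup {r : ℝ | ∃ ξ ∈ HermAlg B A, diamondNorm P B A ξ ≤ 1 ∧ r = pairing φ ξ}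

/-! ### Post-processing deficiency -/

/-- `Ψ` is `(ε, D)`-post-processing deficient with respect to `Φ`. -/
def DeficientOn (P : Family) {A B B' : CAlg} (ε : ℝ) (D : CAlg)
    (Ψ : MatMap A.dim B'.dim) (Φ : MatMap A.dim B.dim) : Prop :=
  ∀ Γ ∈ coneAlg (dualFamily P) D A, ∀ α ∈ Channel P B D, ∃ α' ∈ Channel P B' D,
    pairing (α ∘ₗ Φ) Γ ≤ pairing (α' ∘ₗ Ψ) Γ + ε * dualDiamondNorm P D A Γ

/-- `Ψ` is `ε`-post-processing deficient with respect to `Φ`. -/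
def Deficient (P : Family) {A B B' : CAlg} (ε : ℝ)
    (Ψ : MatMap A.dim B'.dim) (Φ : MatMap A.dim B.dim) : Prop :=
  ∀ D : CAlg, DeficientOn P ε D Ψ Φ

end PostProcessing

open PostProcessing

namespace PostProcessing

open scoped ComplexOrder
open Topology

/-! The channels form a compact convex set, and every Hermitian map lies between `-c • β` and `c •
β` for some channel `β` and some `c > 0`. Hence the balls of the diamond norm are closed with
attained radii, and on the dual cone the dual norm is a maximum of `⟨β, Γ⟩` over channels. Since `⟨α
∘ Φ, Γ⟩ = ⟨α, Φ ∘ Γ⟩`, conditions 1 and 2 compare the same two maxima.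

The quantifiers are exchanged by Hahn-Banach. If `α ∘ Φ` is not below any `α' ∘ Ψ + ε • β`, a
separating functional must lie in the dual cone, and it contradicts 1 (`DeficientOn.exists_le`). The
gap `α' ∘ Ψ + ε • β - α ∘ Φ` multiplies the trace by `ε`, so it is `ε • γ` with a channel `γ`, and
the difference of the two processed maps is `ε • (β - γ)`, of norm at most `2 * ε`. This gives 4.
Conversely, a difference of channels of norm at most `2 * ε` is below `ε` times a channel
(`pairing_sub_channel_le`), which gives 1. The equivalence of 3 and 4 is norm duality, by separation
from a ball plus the set of post-processings.

For the last claim, 4 at `D = B` applied to `E_B` approximates `Φ` itself by some `α' ∘ Ψ`, and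
composing with a channel does not increase the norm. -/

/-! ### The topology of pointwise convergence -/

/-- The space of linear maps with the topology of pointwise convergence. -/
noncomputable instance matMapTopology {m n : ℕ} : TopologicalSpace (MatMap m n) :=
  .induced (fun (φ : MatMap m n) (a : Mat m) => φ a) inferInstance

/-- The inclusion of the linear maps in the functions, as a real linear map. -/
def coeFunLM (m n : ℕ) : MatMap m n →ₗ[ℝ] (Mat m → Mat n) where
  toFun φ a := φ a
  map_add' _ _ := rfl
  map_smul' _ _ := rfl

instance {m n : ℕ} : IsTopologicalAddGroup (MatMap m n) :=
  topologicalAddGroup_induced (coeFunLM m n)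

instance {m n : ℕ} : ContinuousSMul ℝ (MatMap m n) :=
  continuousSMul_induced (coeFunLM m n)

instance {m n : ℕ} : LocallyConvexSpace ℝ (MatMap m n) :=
  have : LocallyConvexSpace ℝ (Mat n) :=
    inferInstanceAs (LocallyConvexSpace ℝ (Fin n → Fin n → ℂ))
  LocallyConvexSpace.induced (coeFunLM m n)

/-- Linearity is a closed condition on functions. This transfers the closedness of the cones, which
is stated for their images among functions, and lets Tychonoff's theorem give compactness. -/
theorem isClosedEmbedding_coeFun {m n : ℕ} :
    IsClosedEmbedding (fun (φ : MatMap m n) (a : Mat m) => φ a) where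
  eq_induced := rfl
  injective _ _ h := DFunLike.coe_injective h
  isClosed_range := LinearMap.isClosed_range_coe (Mat m) (Mat n) (RingHom.id ℂ)

instance {m n : ℕ} : T2Space (MatMap m n) :=
  isClosedEmbedding_coeFun.isEmbedding.t2Space

theorem continuous_apply_matMap {m n : ℕ} (a : Mat m) : Continuous fun φ : MatMap m n => φ a :=
  (continuous_apply a).comp isClosedEmbedding_coeFun.continuous

theorem continuous_matMap {X : Type*} [TopologicalSpace X] {m n : ℕ} {f : X → MatMap m n}
    (hf : ∀ a, Continuous fun x => f x a) : Continuous f :=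
  continuous_induced_rng.2 (continuous_pi hf)

theorem continuous_comp_right {l m n : ℕ} (ψ : MatMap l m) :
    Continuous fun φ : MatMap m n => φ ∘ₗ ψ :=
  continuous_matMap fun a => continuous_apply_matMap (ψ a)

theorem continuous_comp_left {l m n : ℕ} (ψ : MatMap m n) :
    Continuous fun φ : MatMap l m => ψ ∘ₗ φ :=
  continuous_matMap fun a =>
    ψ.continuous_of_finiteDimensional.comp (continuous_apply_matMap a)

theorem IsProperCone.isClosed {m n : ℕ} {Q : Set (MatMap m n)} (hQ : IsProperCone Q) :
    IsClosed Q :=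
  isClosedEmbedding_coeFun.isClosed_iff_image_isClosed.2 hQ.closed

/-! ### Positive matrices -/

/-- Positivity is tested on `e_k + c • e_l`, with the phase `c` chosen so that the cross terms add
up to `-2 * ‖a k l‖`. -/
theorem norm_entry_le_trace {n : ℕ} {a : Mat n} (ha : a.PosSemidef) (k l : Fin n) :
    ‖a k l‖ ≤ a.trace.re := by
  have hd : ∀ i, 0 ≤ (a i i).re := fun i => (Complex.le_def.1 ha.diag_nonneg).1
  have htr : a.trace.re = ∑ i, (a i i).re := by simp [Matrix.trace]
  have hle : ∀ i, (a i i).re ≤ a.trace.re := fun i => by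
    rw [htr]
    exact Finset.single_le_sum (f := fun i => (a i i).re) (fun j _ => hd j) (Finset.mem_univ i)
  obtain ⟨c, hc, hca⟩ : ∃ c : ℂ, ‖c‖ = 1 ∧ c * a k l = -(‖a k l‖ : ℂ) := by
    by_cases h : a k l = 0
    · exact ⟨1, by simp, by simp [h]⟩
    · have h' : (‖a k l‖ : ℂ) ≠ 0 := by simpa using h
      refine ⟨-(starRingEnd ℂ (a k l)) / ‖a k l‖, by simp [h], ?_⟩
      rw [div_mul_eq_mul_div, neg_mul, mul_comm, Complex.mul_conj, Complex.normSq_eq_norm_sq]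
      push_cast
      field_simp
  have hcc : c * starRingEnd ℂ c = 1 := by
    rw [Complex.mul_conj, Complex.normSq_eq_norm_sq, hc]; norm_num
  have hl : a l k = star (a k l) := (ha.isHermitian.apply l k).symm
  have key := ha.dotProduct_mulVec_nonneg (Pi.single k 1 + c • Pi.single l 1)
  have h2 : star (Pi.single k 1 + c • Pi.single l 1 : Fin n → ℂ) ⬝ᵥ
      (a.mulVec (Pi.single k 1 + c • Pi.single l 1)) =
        a k k + c * a k l + star (c * a k l) + a l l := by
    simp [Matrix.mulVec_add, Matrix.mulVec_smul, dotProduct_add, add_dotProduct, hl]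
    linear_combination (a l l) * hcc
  rw [h2, hca] at key
  have := (Complex.le_def.1 key).1
  simp at this
  linarith [hle k, hle l]

open scoped MatrixOrder Matrix.Norms.L2Operator in
theorem exists_pos_sub_posSemidef {n : ℕ} {F : Mat n} (hF : F.IsHermitian) :
    ∃ r : ℝ, 0 < r ∧ ((r : ℂ) • (1 : Mat n) - F).PosSemidef := by
  -- `‖F‖` already dominates; the added 1 only makes the constant strictly positive.
  refine ⟨‖F‖ + 1, by positivity, ?_⟩
  have h1 : F ≤ algebraMap ℝ (Mat n) ‖F‖ := IsSelfAdjoint.le_algebraMap_norm_self (a := F) hF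
  have h2 : (((1 : ℝ) : ℂ) • (1 : Mat n)).PosSemidef := by
    simpa using Matrix.PosSemidef.one
  have h3 := (Matrix.le_iff.1 h1).add h2
  have h4 : (((‖F‖ + 1 : ℝ) : ℂ) • (1 : Mat n) - F) =
      algebraMap ℝ (Mat n) ‖F‖ - F + ((1 : ℝ) : ℂ) • (1 : Mat n) := by
    rw [Algebra.algebraMap_eq_smul_one, ← Complex.coe_smul ‖F‖ (1 : Mat n)]
    push_cast
    module
  rw [h4]
  exact h3

open scoped MatrixOrder Matrix.Norms.L2Operator in
theorem span_posSemidef (n : ℕ) : Submodule.span ℂ {a : Mat n | a.PosSemidef} = ⊤ := by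
  have h := CStarAlgebra.span_nonneg (A := Mat n)
  simpa only [Matrix.nonneg_iff_posSemidef] using h

/-! ### The trace pairing -/

/-- In coordinates the pairing is symmetric in the two maps after exchanging the index pairs. -/
theorem sFun_comp {m n : ℕ} (φ : MatMap m n) (ψ : MatMap n m) :
    sFun (φ ∘ₗ ψ) = ∑ i, ∑ j, ∑ k, ∑ l,
      ψ (Matrix.single i j 1) k l * φ (Matrix.single k l 1) i j := by
  refine Finset.sum_congr rfl fun i _ => Finset.sum_congr rfl fun j _ => ?_
  rw [LinearMap.comp_apply]
  conv_lhs => rw [Matrix.matrix_eq_sum_single (ψ (Matrix.single i j 1))]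
  simp only [map_sum, Matrix.sum_apply]
  refine Finset.sum_congr rfl fun k _ => Finset.sum_congr rfl fun l _ => ?_
  have : Matrix.single k l (ψ (Matrix.single i j 1) k l) =
      ψ (Matrix.single i j 1) k l • Matrix.single k l (1 : ℂ) := by
    rw [Matrix.smul_single, smul_eq_mul, mul_one]
  rw [this, map_smul, Matrix.smul_apply, smul_eq_mul]

theorem sum_comm_pairs {ι ι' κ κ' M : Type*} [Fintype ι] [Fintype ι'] [Fintype κ] [Fintype κ']
    [AddCommMonoid M] (f : ι → ι' → κ → κ' → M) :
    ∑ i, ∑ j, ∑ k, ∑ l, f i j k l = ∑ k, ∑ l, ∑ i, ∑ j, f i j k l :=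
  calc
    _ = ∑ i, ∑ k, ∑ j, ∑ l, f i j k l := Finset.sum_congr rfl fun _ _ => Finset.sum_comm
    _ = ∑ k, ∑ i, ∑ j, ∑ l, f i j k l := Finset.sum_comm
    _ = ∑ k, ∑ i, ∑ l, ∑ j, f i j k l :=
      Finset.sum_congr rfl fun _ _ => Finset.sum_congr rfl fun _ _ => Finset.sum_comm
    _ = _ := Finset.sum_congr rfl fun _ _ => Finset.sum_comm

theorem sFun_comp_comm {m n : ℕ} (φ : MatMap m n) (ψ : MatMap n m) :
    sFun (φ ∘ₗ ψ) = sFun (ψ ∘ₗ φ) := by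
  rw [sFun_comp, sFun_comp]
  rw [sum_comm_pairs]
  refine Finset.sum_congr rfl fun i _ => Finset.sum_congr rfl fun j _ =>
    Finset.sum_congr rfl fun k _ => Finset.sum_congr rfl fun l _ => mul_comm _ _

theorem pairing_comm {m n : ℕ} (φ : MatMap m n) (ψ : MatMap n m) :
    pairing φ ψ = pairing ψ φ := by
  rw [pairing, sFun_comp_comm, pairing]

theorem pairing_comp_left {l m n : ℕ} (α : MatMap m n) (φ : MatMap l m) (Γ : MatMap n l) :
    pairing (α ∘ₗ φ) Γ = pairing α (φ ∘ₗ Γ) := rfl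

/-- The functional `⟨·, Γ⟩` on linear maps. -/
noncomputable def pairingLM {m n : ℕ} (Γ : MatMap n m) : MatMap m n →ₗ[ℝ] ℝ where
  toFun φ := pairing φ Γ
  map_add' φ ψ := by
    simp [pairing, sFun, Finset.sum_add_distrib]
  map_smul' c φ := by
    simp [pairing, sFun, Finset.mul_sum]

@[simp]
theorem pairingLM_apply {m n : ℕ} (Γ : MatMap n m) (φ : MatMap m n) :
    pairingLM Γ φ = pairing φ Γ := rfl

/-! ### Hermitian maps -/

theorem Herm.map_conjTranspose {m n : ℕ} {φ : MatMap m n} (hφ : φ ∈ Herm m n) (a : Mat m) :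
    φ a.conjTranspose = (φ a).conjTranspose := by
  have h1 := hφ _ (realPart a).2
  have h2 := hφ _ (imaginaryPart a).2
  have h3 : (realPart a : Mat m).conjTranspose = realPart a := (realPart a).2
  have h4 : (imaginaryPart a : Mat m).conjTranspose = imaginaryPart a := (imaginaryPart a).2
  rw [← realPart_add_I_smul_imaginaryPart a]
  simp only [Matrix.conjTranspose_add, Matrix.conjTranspose_smul, map_add, map_smul, h3, h4,
    h1.eq, h2.eq]

theorem Herm.comp {l m n : ℕ} {φ : MatMap l m} {ψ : MatMap m n} (hφ : φ ∈ Herm l m)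
    (hψ : ψ ∈ Herm m n) : ψ ∘ₗ φ ∈ Herm l n :=
  fun a ha => hψ _ (hφ a ha)

/-- The adjoint map `a ↦ φ(a^*)^*`. -/
def starMap {m n : ℕ} (φ : MatMap m n) : MatMap m n where
  toFun a := (φ a.conjTranspose).conjTranspose
  map_add' a b := by simp
  map_smul' c a := by simp

theorem sFun_comp_starMap {m n : ℕ} {φ : MatMap m n} (hφ : φ ∈ Herm m n) (G : MatMap n m) :
    sFun (φ ∘ₗ starMap G) = star (sFun (φ ∘ₗ G)) := by
  rw [sFun, sFun, star_sum, Finset.sum_comm]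
  refine Finset.sum_congr rfl fun i _ => ?_
  rw [star_sum]
  refine Finset.sum_congr rfl fun j _ => ?_
  simp [starMap, Herm.map_conjTranspose hφ]

theorem half_add_starMap_mem_herm {m n : ℕ} (G : MatMap m n) :
    (1 / 2 : ℝ) • (G + starMap G) ∈ Herm m n := by
  refine (Herm m n).smul_mem _ fun a ha => ?_
  simp only [LinearMap.add_apply, starMap, LinearMap.coe_mk, AddHom.coe_mk, ha.eq]
  exact Matrix.isHermitian_add_transpose_self _

/-- Every complex functional on linear maps is of the form `φ ↦ s(φ ∘ G)`. -/
theorem exists_sFun_comp_eq {m n : ℕ} (g : MatMap m n →ₗ[ℂ] ℂ) :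
    ∃ G : MatMap n m, ∀ φ, sFun (φ ∘ₗ G) = g φ := by
  let e (k l : Fin m) (a : Mat n) : MatMap m n := (Matrix.entryLinearMap ℂ ℂ k l).smulRight a
  let G : MatMap n m :=
    { toFun := fun a => Matrix.of fun k l => g (e k l a)
      map_add' := fun a b => by
        ext k l
        have : e k l (a + b) = e k l a + e k l b := by
          ext1 x; simp [e]
        simp [this]
      map_smul' := fun c a => by
        ext k l
        have : e k l (c • a) = c • e k l a := by
          ext1 x; exact smul_comm (x k l) c a
        simp [this] }
  refine ⟨G, fun φ => ?_⟩
  -- The maps `e k l (E_ij)` form the matrix unit basis; the coefficients of `φ` in it are the ones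
  -- that occur in `sFun_comp`.
  have hφ : φ = ∑ i, ∑ j, ∑ k, ∑ l,
      φ (Matrix.single k l 1) i j • e k l (Matrix.single i j 1) := by
    have hs : ∀ {d : ℕ} (x : Mat d), x = ∑ k, ∑ l, x k l • Matrix.single k l (1 : ℂ) := fun x => by
      conv_lhs => rw [Matrix.matrix_eq_sum_single x]
      simp [Matrix.smul_single]
    refine LinearMap.ext fun x => ?_
    conv_lhs => rw [hs x]
    simp only [map_sum, map_smul]
    conv_lhs =>
      enter [2, k, 2, l]
      rw [hs (φ (Matrix.single k l 1))]
    simp only [Finset.smul_sum, LinearMap.sum_apply]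
    rw [sum_comm_pairs]
    exact Finset.sum_congr rfl fun i _ => Finset.sum_congr rfl fun j _ =>
      Finset.sum_congr rfl fun k _ => Finset.sum_congr rfl fun l _ => smul_comm _ _ _
  conv_rhs => rw [hφ]
  rw [sFun_comp]
  simp only [map_sum, map_smul, smul_eq_mul]
  refine Finset.sum_congr rfl fun i _ => Finset.sum_congr rfl fun j _ =>
    Finset.sum_congr rfl fun k _ => Finset.sum_congr rfl fun l _ => ?_
  rw [mul_comm]
  rfl

/-- Every real functional on Hermitian maps is of the form `⟨·, Γ⟩` with a Hermitian `Γ`. -/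
theorem exists_pairing_eq {m n : ℕ} (f : MatMap m n →ₗ[ℝ] ℝ) :
    ∃ Γ ∈ Herm n m, ∀ φ ∈ Herm m n, pairing φ Γ = f φ := by
  obtain ⟨G, hG⟩ := exists_sFun_comp_eq (Module.Dual.extendRCLike (𝕜 := ℂ) f)
  -- Passing to the Hermitian part of `G` is harmless: on Hermitian `φ`, `starMap` only conjugates
  -- the value of `s`.
  refine ⟨_, half_add_starMap_mem_herm G, fun φ hφ => ?_⟩
  have h1 : pairing φ G = f φ := by
    rw [pairing, hG]
    simp [Module.Dual.extendRCLike_apply]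
  have h2 : pairing φ (starMap G) = f φ := by
    rw [← h1, pairing, sFun_comp_starMap hφ]
    simp [pairing]
  rw [pairing_comm, ← pairingLM_apply, map_smul, map_add, pairingLM_apply, pairingLM_apply,
    pairing_comm, h1, pairing_comm, h2]
  simp
  ring

/-! ### The conditional expectation -/

namespace CAlg

theorem condExp_apply (A : CAlg) (a : Mat A.dim) (i j : Fin A.dim) :
    A.condExp a i j = if A.label i = A.label j then a i j else 0 := rfl

theorem condExp_comp_condExp (A : CAlg) : A.condExp ∘ₗ A.condExp = A.condExp := by
  ext1 a
  ext i j
  simp only [LinearMap.comp_apply, condExp_apply]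
  split_ifs <;> rfl

theorem trace_condExp (A : CAlg) (a : Mat A.dim) : (A.condExp a).trace = a.trace := by
  simp [Matrix.trace, condExp_apply]

theorem condExp_mem_herm (A : CAlg) : A.condExp ∈ Herm A.dim A.dim := by
  intro a ha
  ext i j
  rw [Matrix.conjTranspose_apply, condExp_apply, condExp_apply]
  by_cases h : A.label i = A.label j
  · rw [if_pos h, if_pos h.symm, ha.apply]
  · rw [if_neg h, if_neg (Ne.symm h), star_zero]

theorem condExp_mem_cp (A : CAlg) : A.condExp ∈ CP A.dim A.dim := by
  refine ⟨A.condExp_mem_herm, fun k X hX => ?_⟩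
  let d (t : ℕ) : Matrix (Fin A.dim × Fin k) (Fin A.dim × Fin k) ℂ :=
    Matrix.diagonal fun p => if A.label p.1 = t then 1 else 0
  -- Kraus form: the expectation is the sum of the compressions to the blocks, one for each label
  -- that occurs.
  have h : tensorId A.condExp k X =
      ∑ t ∈ Finset.univ.image A.label, (d t).conjTranspose * X * d t := by
    ext p q
    simp only [tensorId, Matrix.of_apply, condExp_apply, Matrix.sum_apply, d,
      Matrix.diagonal_conjTranspose, Matrix.mul_diagonal, Matrix.diagonal_mul, Pi.star_apply]
    rw [Finset.sum_eq_single (A.label p.1)]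
    · by_cases h : A.label p.1 = A.label q.1 <;> simp [h, eq_comm]
    · intro t _ ht
      simp [Ne.symm ht]
    · intro h
      simp at h
  rw [h]
  exact Matrix.posSemidef_sum _ fun t _ => hX.conjTranspose_mul_mul_same _

end CAlg

theorem mem_hermAlg_iff {A B : CAlg} {φ : MatMap A.dim B.dim} :
    φ ∈ HermAlg A B ↔ φ ∈ Herm A.dim B.dim ∧ B.condExp ∘ₗ φ = φ ∧ φ ∘ₗ A.condExp = φ := by
  refine ⟨fun ⟨h, he⟩ => ⟨h, ?_, ?_⟩, fun ⟨h, h1, h2⟩ => ⟨h, by rw [h2, h1]⟩⟩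
  · rw [← he, ← LinearMap.comp_assoc, B.condExp_comp_condExp]
  · rw [← he, LinearMap.comp_assoc, LinearMap.comp_assoc, A.condExp_comp_condExp]

theorem compress_mem_hermAlg {A B : CAlg} {φ : MatMap A.dim B.dim} (h : φ ∈ Herm A.dim B.dim) :
    B.condExp ∘ₗ φ ∘ₗ A.condExp ∈ HermAlg A B := by
  refine mem_hermAlg_iff.2 ⟨Herm.comp (Herm.comp A.condExp_mem_herm h) B.condExp_mem_herm, ?_, ?_⟩
  · rw [← LinearMap.comp_assoc, B.condExp_comp_condExp]
  · rw [LinearMap.comp_assoc, LinearMap.comp_assoc, A.condExp_comp_condExp]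

theorem HermAlg.comp {A B C : CAlg} {φ : MatMap A.dim B.dim} {ψ : MatMap B.dim C.dim}
    (hφ : φ ∈ HermAlg A B) (hψ : ψ ∈ HermAlg B C) : ψ ∘ₗ φ ∈ HermAlg A C := by
  rw [mem_hermAlg_iff] at *
  refine ⟨Herm.comp hφ.1 hψ.1, ?_, ?_⟩
  · rw [← LinearMap.comp_assoc, hψ.2.1]
  · rw [LinearMap.comp_assoc, hφ.2.2]

/-- `L(A,B)` as a real vector space. -/
def hermAlgSubmodule (A B : CAlg) : Submodule ℝ (MatMap A.dim B.dim) where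
  carrier := HermAlg A B
  zero_mem' := ⟨zero_mem _, by simp⟩
  add_mem' := fun ha hb => ⟨add_mem ha.1 hb.1, by
    rw [LinearMap.add_comp, LinearMap.comp_add, ha.2, hb.2]⟩
  smul_mem' := fun c φ h => ⟨Submodule.smul_mem _ c h.1, by
    have h2 : B.condExp ∘ₗ (c • φ) ∘ₗ A.condExp = c • (B.condExp ∘ₗ φ ∘ₗ A.condExp) := by
      ext1 x
      simp
    rw [h2, h.2]⟩

/-- By cyclicity of `s` the expectations move from `Γ` to `φ`, which absorbs them. So functionals on
`L(A,B)` are represented inside `L(B,A)`. -/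
theorem pairing_compress {A B : CAlg} {φ : MatMap A.dim B.dim} (hφ : φ ∈ HermAlg A B)
    (Γ : MatMap B.dim A.dim) :
    pairing φ (A.condExp ∘ₗ Γ ∘ₗ B.condExp) = pairing φ Γ := by
  conv_rhs => rw [← hφ.2]
  rw [pairing, pairing, LinearMap.comp_assoc, sFun_comp_comm B.condExp]
  rfl

theorem isClosed_herm (m n : ℕ) : IsClosed (Herm m n : Set (MatMap m n)) := by
  have : (Herm m n : Set (MatMap m n)) =
      ⋂ a : Mat m, ⋂ _ : a.IsHermitian, {φ | (φ a).conjTranspose = φ a} := by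
    ext φ
    simp [Herm, Matrix.IsHermitian]
  rw [this]
  refine isClosed_iInter fun a => isClosed_iInter fun _ => isClosed_eq ?_ ?_
  · exact (continuous_apply_matMap a).matrix_conjTranspose
  · exact continuous_apply_matMap a

theorem isClosed_hermAlg (A B : CAlg) : IsClosed (HermAlg A B) :=
  (isClosed_herm _ _).inter <| isClosed_eq
    ((continuous_comp_left _).comp (continuous_comp_right _)) continuous_id

/-! ### The cones `P(A,B)` -/

section coneAlg

variable {P : Family} {A B C : CAlg}

theorem isClosed_coneAlg (hP : IsAdmissible P) : IsClosed (coneAlg P A B) :=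
  (hP.proper _ _).isClosed.inter (isClosed_hermAlg A B)

theorem coneAlg_add (hP : IsAdmissible P) {φ ψ : MatMap A.dim B.dim} (hφ : φ ∈ coneAlg P A B)
    (hψ : ψ ∈ coneAlg P A B) : φ + ψ ∈ coneAlg P A B :=
  ⟨(hP.proper _ _).add_mem _ hφ.1 _ hψ.1, (hermAlgSubmodule A B).add_mem hφ.2 hψ.2⟩

theorem coneAlg_smul (hP : IsAdmissible P) {φ : MatMap A.dim B.dim} {c : ℝ} (hc : 0 ≤ c)
    (hφ : φ ∈ coneAlg P A B) : c • φ ∈ coneAlg P A B :=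
  ⟨(hP.proper _ _).smul_mem _ hc _ hφ.1, (hermAlgSubmodule A B).smul_mem c hφ.2⟩

theorem zero_mem_coneAlg (hP : IsAdmissible P) : (0 : MatMap A.dim B.dim) ∈ coneAlg P A B :=
  ⟨(hP.proper _ _).zero_mem, (hermAlgSubmodule A B).zero_mem⟩

theorem convex_coneAlg (hP : IsAdmissible P) : Convex ℝ (coneAlg P A B) :=
  fun _ hx _ hy _ _ ha hb _ => coneAlg_add hP (coneAlg_smul hP ha hx) (coneAlg_smul hP hb hy)

theorem coneAlg_comp (hP : IsAdmissible P) {φ : MatMap A.dim B.dim} {ψ : MatMap B.dim C.dim}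
    (hφ : φ ∈ coneAlg P A B) (hψ : ψ ∈ coneAlg P B C) : ψ ∘ₗ φ ∈ coneAlg P A C :=
  ⟨hP.comp_mem _ _ _ _ hφ.1 _ hψ.1, HermAlg.comp hφ.2 hψ.2⟩

theorem compress_mem_coneAlg (hP : IsAdmissible P) {φ : MatMap A.dim B.dim}
    (h : φ ∈ P A.dim B.dim) : B.condExp ∘ₗ φ ∘ₗ A.condExp ∈ coneAlg P A B :=
  ⟨hP.cp_comp_mem _ _ _ _ _ A.condExp_mem_cp _ h _ B.condExp_mem_cp,
    compress_mem_hermAlg ((hP.proper _ _).subset_herm h)⟩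

theorem eq_zero_of_trace_eq_zero (hP : IsAdmissible P) {φ : MatMap A.dim B.dim}
    (hφ : φ ∈ coneAlg P A B) (htr : ∀ a, (φ a).trace = 0) : φ = 0 := by
  refine LinearMap.ext_on (span_posSemidef _) fun a ha => ?_
  exact Matrix.PosSemidef.trace_eq_zero_iff ((hP.subset_pos _ _ hφ.1).2 a ha) |>.1 (htr a)

/-! ### Channels -/

/-- The map `a ↦ Tr(F a) σ`. -/
noncomputable def measurePrepare {m n : ℕ} (F : Mat m) (σ : Mat n) : MatMap m n :=
  (Matrix.traceLinearMap (Fin m) ℂ ℂ ∘ₗ LinearMap.mulLeft ℂ F).smulRight σ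

theorem measurePrepare_apply {m n : ℕ} (F : Mat m) (σ : Mat n) (a : Mat m) :
    measurePrepare F σ a = (F * a).trace • σ := rfl

theorem measurePrepare_mem_eb {m n : ℕ} {F : Mat m} {σ : Mat n} (hF : F.PosSemidef)
    (hσ : σ.PosSemidef) : measurePrepare F σ ∈ EB m n :=
  ⟨1, fun _ => F, fun _ => σ, fun _ => hF, fun _ => hσ, fun a => by
    simp [measurePrepare_apply]⟩

/-- The maximally mixed state. -/
noncomputable def maxMixed (n : ℕ) : Mat n := ((n : ℂ)⁻¹) • (1 : Mat n)

theorem maxMixed_posSemidef (n : ℕ) : (maxMixed n).PosSemidef :=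
  Matrix.PosSemidef.one.smul (by simp)

theorem trace_maxMixed (A : CAlg) : (maxMixed A.dim).trace = 1 := by
  have : (A.dim : ℂ) ≠ 0 := by exact_mod_cast A.dim_pos.ne'
  simp [maxMixed, this]

theorem condExp_maxMixed (A : CAlg) : A.condExp (maxMixed A.dim) = maxMixed A.dim := by
  ext i j
  rw [CAlg.condExp_apply]
  by_cases h : i = j
  · simp [h]
  · simp [maxMixed, h]

/-- The condition `htr` says that `F` is block diagonal; the maximally mixed state is so in every
algebra. -/
theorem measurePrepare_mem_coneAlg (hP : IsAdmissible P) {F : Mat A.dim} (hF : F.PosSemidef)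
    (htr : ∀ a, (F * A.condExp a).trace = (F * a).trace) :
    measurePrepare F (maxMixed B.dim) ∈ coneAlg P A B := by
  have h := hP.eb_subset _ _ (measurePrepare_mem_eb hF (maxMixed_posSemidef B.dim))
  refine ⟨h, mem_hermAlg_iff.2 ⟨(hP.proper _ _).subset_herm h, ?_, ?_⟩⟩
  · ext1 a
    simp [measurePrepare_apply, condExp_maxMixed]
  · ext1 a
    simp [measurePrepare_apply, htr]

theorem trace_measurePrepare_maxMixed (F a : Mat A.dim) :
    (measurePrepare F (maxMixed B.dim) a).trace = (F * a).trace := by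
  simp [measurePrepare_apply, trace_maxMixed]

theorem channel_nonempty (hP : IsAdmissible P) (A B : CAlg) : (Channel P A B).Nonempty :=
  ⟨measurePrepare 1 (maxMixed B.dim), measurePrepare_mem_coneAlg hP Matrix.PosSemidef.one
    fun a => by simp [CAlg.trace_condExp], fun a => by simp [trace_measurePrepare_maxMixed]⟩

theorem channel_comp (hP : IsAdmissible P) {φ : MatMap A.dim B.dim} {ψ : MatMap B.dim C.dim}
    (hφ : φ ∈ Channel P A B) (hψ : ψ ∈ Channel P B C) : ψ ∘ₗ φ ∈ Channel P A C :=
  ⟨coneAlg_comp hP hφ.1 hψ.1, fun a => by rw [LinearMap.comp_apply, hψ.2, hφ.2]⟩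

theorem convex_channel (hP : IsAdmissible P) : Convex ℝ (Channel P A B) :=
  fun x hx y hy a b ha hb hab => ⟨convex_coneAlg hP hx.1 hy.1 ha hb hab, fun c => by
    have : (a : ℂ) + b = 1 := by exact_mod_cast hab
    simp [hx.2, hy.2, ← add_mul, this]⟩

/-! ### Compactness of the set of channels. -/

/-- The elements of `P(A,B)` that multiply the trace of positive operators by at most `t`. -/
def traceLe (P : Family) (A B : CAlg) (t : ℝ) : Set (MatMap A.dim B.dim) :=
  {φ | φ ∈ coneAlg P A B ∧ ∀ a : Mat A.dim, a.PosSemidef → (φ a).trace.re ≤ t * a.trace.re}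

theorem exists_bound_of_trace_le (hP : IsAdmissible P) (t : ℝ) (a : Mat A.dim) :
    ∃ c : ℝ, ∀ φ ∈ traceLe P A B t, ∀ k l, ‖φ a k l‖ ≤ c := by
  have ha : a ∈ Submodule.span ℂ {a : Mat A.dim | a.PosSemidef} := by
    rw [span_posSemidef]; trivial
  induction ha using Submodule.span_induction with
  | mem x hx =>
    refine ⟨t * x.trace.re, fun φ hφ k l => ?_⟩
    exact (norm_entry_le_trace ((hP.subset_pos _ _ hφ.1.1).2 x hx) k l).trans (hφ.2 x hx)
  | zero => exact ⟨0, fun φ _ k l => by simp⟩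
  | add x y _ _ hx hy =>
    obtain ⟨c, hc⟩ := hx
    obtain ⟨d, hd⟩ := hy
    refine ⟨c + d, fun φ hφ k l => ?_⟩
    rw [map_add, Matrix.add_apply]
    exact norm_add_le_of_le (hc φ hφ k l) (hd φ hφ k l)
  | smul z x _ hx =>
    obtain ⟨c, hc⟩ := hx
    refine ⟨‖z‖ * c, fun φ hφ k l => ?_⟩
    rw [map_smul, Matrix.smul_apply, norm_smul]
    exact mul_le_mul_of_nonneg_left (hc φ hφ k l) (norm_nonneg _)

theorem isClosed_channel (hP : IsAdmissible P) : IsClosed (Channel P A B) := by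
  have : Channel P A B = coneAlg P A B ∩ ⋂ a : Mat A.dim, {φ | (φ a).trace = a.trace} := by
    ext φ
    simp [Channel]
  rw [this]
  exact (isClosed_coneAlg hP).inter <| isClosed_iInter fun a =>
    isClosed_eq (continuous_apply_matMap a).matrix_trace continuous_const

theorem isClosed_traceLe (hP : IsAdmissible P) (t : ℝ) : IsClosed (traceLe P A B t) := by
  have : traceLe P A B t = coneAlg P A B ∩
      ⋂ a : Mat A.dim, ⋂ _ : a.PosSemidef, {φ | (φ a).trace.re ≤ t * a.trace.re} := by
    ext φ
    simp [traceLe]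
  rw [this]
  exact (isClosed_coneAlg hP).inter <| isClosed_iInter fun a => isClosed_iInter fun _ =>
    isClosed_le (Complex.continuous_re.comp (continuous_apply_matMap a).matrix_trace)
      continuous_const

/-- Pointwise bounds place the set in a product of boxes. The case `t = 1` contains the channels,
and `t = 2` the maps `β + ξ` with `-β ≤ ξ ≤ β`. -/
theorem isCompact_traceLe (hP : IsAdmissible P) (t : ℝ) : IsCompact (traceLe P A B t) := by
  choose c hc using exists_bound_of_trace_le (B := B) hP t
  let K (a : Mat A.dim) : Set (Mat B.dim) :=
    Set.pi Set.univ fun _ => Set.pi Set.univ fun _ => Metric.closedBall 0 (c a)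
  have hK : ∀ a, IsCompact (K a) := fun a =>
    isCompact_univ_pi fun _ => isCompact_univ_pi fun _ => isCompact_closedBall _ _
  refine (isClosedEmbedding_coeFun.isCompact_preimage (isCompact_univ_pi hK)).of_isClosed_subset
    (isClosed_traceLe hP t) fun φ hφ a _ k _ l _ => ?_
  rw [mem_closedBall_zero_iff]
  exact hc a φ hφ k l

theorem isCompact_channel (hP : IsAdmissible P) : IsCompact (Channel P A B) :=
  (isCompact_traceLe hP 1).of_isClosed_subset (isClosed_channel hP)
    fun φ hφ => ⟨hφ.1, fun a _ => by rw [hφ.2, one_mul]⟩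

/-! ### Domination by multiples of channels. -/

/-- An element of `P(A,B)` that multiplies the trace by `c` is `c` times a channel. -/
theorem exists_channel_eq_smul (hP : IsAdmissible P) {φ : MatMap A.dim B.dim}
    (hφ : φ ∈ coneAlg P A B) {c : ℝ} (hc : 0 ≤ c) (htr : ∀ a, (φ a).trace = c * a.trace) :
    ∃ β ∈ Channel P A B, φ = c • β := by
  rcases hc.eq_or_lt with rfl | hc
  · obtain ⟨β, hβ⟩ := channel_nonempty hP A B
    refine ⟨β, hβ, ?_⟩
    rw [zero_smul]
    exact eq_zero_of_trace_eq_zero hP hφ fun a => by simp [htr]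
  · refine ⟨c⁻¹ • φ, ⟨coneAlg_smul hP (by positivity) hφ, fun a => ?_⟩, ?_⟩
    · have : (c : ℂ) ≠ 0 := by exact_mod_cast hc.ne'
      simp [htr, this]
    · rw [smul_smul, mul_inv_cancel₀ hc.ne', one_smul]

/-- The matrix `F` represents `a ↦ Tr ψ(a)`. For `r • 1 - F ≥ 0`, adding the measure-and-prepare map
of `r • 1 - F` to `ψ` yields a map that multiplies the trace by `r`. -/
theorem exists_smul_channel_sub_mem (hP : IsAdmissible P) {ψ : MatMap A.dim B.dim}
    (hψ : ψ ∈ coneAlg P A B) :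
    ∃ r : ℝ, 0 < r ∧ ∃ β ∈ Channel P A B, r • β - ψ ∈ coneAlg P A B := by
  let F : Mat A.dim := Matrix.of fun l k => (ψ (Matrix.single k l 1)).trace
  have hF : ∀ a, (F * a).trace = (ψ a).trace := fun a => by
    conv_rhs => rw [Matrix.matrix_eq_sum_single a]
    have : ∀ k l, Matrix.single k l (a k l) = a k l • Matrix.single k l (1 : ℂ) := fun k l => by
      simp [Matrix.smul_single]
    simp only [this, map_sum, map_smul, Matrix.trace_sum, Matrix.trace_smul, smul_eq_mul]
    rw [Finset.sum_comm]
    simp [Matrix.trace, Matrix.mul_apply, F, mul_comm]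
  have hFh : F.IsHermitian := by
    ext l k
    simp only [F, Matrix.conjTranspose_apply, Matrix.of_apply]
    rw [← Matrix.trace_conjTranspose, ← Herm.map_conjTranspose hψ.2.1]
    simp
  obtain ⟨r, hr, hrF⟩ := exists_pos_sub_posSemidef hFh
  have htr : ∀ a, (((r : ℂ) • (1 : Mat A.dim) - F) * a).trace = r * a.trace - (ψ a).trace :=
    fun a => by simp [sub_mul, hF]
  have hM : measurePrepare ((r : ℂ) • (1 : Mat A.dim) - F) (maxMixed B.dim) ∈ coneAlg P A B := by
    refine measurePrepare_mem_coneAlg hP hrF fun a => ?_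
    rw [htr, htr, A.trace_condExp, ← LinearMap.comp_apply, (mem_hermAlg_iff.1 hψ.2).2.2]
  obtain ⟨β, hβ, h⟩ := exists_channel_eq_smul hP (coneAlg_add hP hψ hM) hr.le fun a => by
    rw [LinearMap.add_apply, Matrix.trace_add, trace_measurePrepare_maxMixed, htr]
    ring
  exact ⟨r, hr, β, hβ, by rw [← h, add_sub_cancel_left]; exact hM⟩

/-- If `ξ = φ₁ - φ₂` with both terms in the cone, a multiple of a channel above `φ₁ + φ₂` dominates
both `ξ` and `-ξ`. Hence the unit ball is absorbing in `L(A,B)`. -/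
theorem exists_smul_channel_add_sub_mem (hP : IsAdmissible P) {ξ : MatMap A.dim B.dim}
    (hξ : ξ ∈ HermAlg A B) :
    ∃ r : ℝ, 0 < r ∧ ∃ β ∈ Channel P A B,
      r • β + ξ ∈ coneAlg P A B ∧ r • β - ξ ∈ coneAlg P A B := by
  obtain ⟨ψ₁, h₁, ψ₂, h₂, h⟩ := (hP.proper _ _).generating ξ hξ.1
  have hs : ξ = B.condExp ∘ₗ ψ₁ ∘ₗ A.condExp - B.condExp ∘ₗ ψ₂ ∘ₗ A.condExp := by
    rw [← hξ.2, h, LinearMap.sub_comp, LinearMap.comp_sub]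
  have h₁ := compress_mem_coneAlg hP h₁
  have h₂ := compress_mem_coneAlg hP h₂
  generalize B.condExp ∘ₗ ψ₁ ∘ₗ A.condExp = φ₁ at *
  generalize B.condExp ∘ₗ ψ₂ ∘ₗ A.condExp = φ₂ at *
  obtain ⟨r, hr, β, hβ, hm⟩ := exists_smul_channel_sub_mem hP (coneAlg_add hP h₁ h₂)
  refine ⟨r, hr, β, hβ, ?_, ?_⟩
  · convert coneAlg_add hP hm (coneAlg_add hP h₁ h₁) using 1
    rw [hs]; abel
  · convert coneAlg_add hP hm (coneAlg_add hP h₂ h₂) using 1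
    rw [hs]; abel

end coneAlg

open scoped Pointwise

/-! ### The diamond norm and its dual -/

theorem isClosed_setOf_exists_mem_isCompact {X Y : Type*} [TopologicalSpace X]
    [TopologicalSpace Y] {K : Set Y} (hK : IsCompact K) {S : Set (X × Y)} (hS : IsClosed S) :
    IsClosed {x | ∃ y ∈ K, (x, y) ∈ S} := by
  have := isCompact_iff_compactSpace.1 hK
  have h := isClosedMap_fst_of_compactSpace (X := X) (Y := K) _
    (hS.preimage (continuous_id.prodMap continuous_subtype_val))
  convert h using 1
  ext x
  simp

theorem continuous_pairing {m n : ℕ} (Γ : MatMap n m) :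
    Continuous fun φ : MatMap m n => pairing φ Γ :=
  Complex.continuous_re.comp <| continuous_finsetSum _ fun _ _ => continuous_finsetSum _ fun _ _ =>
    (continuous_apply_matMap _).matrix_elem _ _

section norms

variable {P : Family} {A B C : CAlg}

/-- The ball of radius `c` for the diamond norm. -/
def diamondBall (P : Family) (A B : CAlg) (c : ℝ) : Set (MatMap A.dim B.dim) :=
  {y | ∃ β ∈ Channel P A B, c • β + y ∈ coneAlg P A B ∧ c • β - y ∈ coneAlg P A B}

theorem diamondBall_zero (hP : IsAdmissible P) {y : MatMap A.dim B.dim}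
    (hy : y ∈ diamondBall P A B 0) : y = 0 := by
  obtain ⟨β, -, h1, h2⟩ := hy
  rw [zero_smul, zero_add] at h1
  rw [zero_smul, zero_sub] at h2
  exact (hP.proper _ _).pointed y h1.1 h2.1

theorem mem_hermAlg_of_mem_diamondBall {c : ℝ} {y : MatMap A.dim B.dim}
    (hy : y ∈ diamondBall P A B c) : y ∈ HermAlg A B := by
  obtain ⟨β, hβ, h1, h2⟩ := hy
  have := (hermAlgSubmodule A B).sub_mem h1.2 ((hermAlgSubmodule A B).smul_mem c hβ.1.2)
  rwa [add_sub_cancel_left] at this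

theorem smul_mem_diamondBall (hP : IsAdmissible P) {c t : ℝ} (ht : 0 ≤ t)
    {y : MatMap A.dim B.dim} (hy : y ∈ diamondBall P A B c) :
    t • y ∈ diamondBall P A B (t * c) := by
  obtain ⟨β, hβ, h1, h2⟩ := hy
  refine ⟨β, hβ, ?_, ?_⟩
  · rw [mul_smul, ← smul_add]
    exact coneAlg_smul hP ht h1
  · convert coneAlg_smul hP ht h2 using 1
    module

theorem diamondBall_mono (hP : IsAdmissible P) {c d : ℝ} (h : c ≤ d) :
    diamondBall P A B c ⊆ diamondBall P A B d := by
  rintro y ⟨β, hβ, h1, h2⟩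
  have h3 := coneAlg_smul hP (sub_nonneg.2 h) hβ.1
  refine ⟨β, hβ, ?_, ?_⟩
  · convert coneAlg_add hP h3 h1 using 1
    module
  · convert coneAlg_add hP h3 h2 using 1
    module

theorem convex_diamondBall (hP : IsAdmissible P) (c : ℝ) : Convex ℝ (diamondBall P A B c) := by
  rintro x ⟨β, hβ, h1, h2⟩ y ⟨γ, hγ, h3, h4⟩ a b ha hb hab
  refine ⟨a • β + b • γ, convex_channel hP hβ hγ ha hb hab, ?_, ?_⟩
  · convert convex_coneAlg hP h1 h3 ha hb hab using 1
    module
  · convert convex_coneAlg hP h2 h4 ha hb hab using 1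
    module

theorem isClosed_diamondBall (hP : IsAdmissible P) (c : ℝ) : IsClosed (diamondBall P A B c) :=
  isClosed_setOf_exists_mem_isCompact (isCompact_channel hP)
    (S := {p : MatMap A.dim B.dim × MatMap A.dim B.dim |
      c • p.2 + p.1 ∈ coneAlg P A B ∧ c • p.2 - p.1 ∈ coneAlg P A B})
    (((isClosed_coneAlg hP).preimage (by fun_prop)).inter
      ((isClosed_coneAlg hP).preimage (by fun_prop)))

theorem isClosed_radii (hP : IsAdmissible P) (y : MatMap A.dim B.dim) :
    IsClosed {c : ℝ | y ∈ diamondBall P A B c} :=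
  isClosed_setOf_exists_mem_isCompact (isCompact_channel hP)
    (S := {p : ℝ × MatMap A.dim B.dim |
      p.1 • p.2 + y ∈ coneAlg P A B ∧ p.1 • p.2 - y ∈ coneAlg P A B})
    (((isClosed_coneAlg hP).preimage (by fun_prop)).inter
      ((isClosed_coneAlg hP).preimage (by fun_prop)))

theorem mem_smul_unitBall_iff (hP : IsAdmissible P) {c : ℝ} (hc : 0 < c)
    {y : MatMap A.dim B.dim} :
    y ∈ c • {y | ∃ b ∈ Channel P A B, y - -b ∈ coneAlg P A B ∧ b - y ∈ coneAlg P A B} ↔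
      y ∈ diamondBall P A B c := by
  have h1 : {y | ∃ b ∈ Channel P A B, y - -b ∈ coneAlg P A B ∧ b - y ∈ coneAlg P A B} =
      diamondBall P A B 1 := by
    ext y
    simp [diamondBall, add_comm]
  rw [h1, Set.mem_smul_set_iff_inv_smul_mem₀ hc.ne']
  constructor
  · intro h
    simpa [smul_smul, hc.ne'] using smul_mem_diamondBall hP hc.le h
  · intro h
    simpa [hc.ne'] using smul_mem_diamondBall hP (inv_nonneg.2 hc.le) h

/-- The infimum in the gauge is attained because the set of radii is closed; radius 0 uses
pointedness. Outside `L(A,B)` the gauge is the infimum of the empty set, that is 0, hence `hy`. -/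
theorem diamondNorm_le_iff (hP : IsAdmissible P) {c : ℝ} (hc : 0 ≤ c) {y : MatMap A.dim B.dim}
    (hy : y ∈ HermAlg A B) : diamondNorm P A B y ≤ c ↔ y ∈ diamondBall P A B c := by
  constructor
  · intro h
    have hsub : Set.Ioi c ⊆ {c : ℝ | y ∈ diamondBall P A B c} := by
      intro d hd
      obtain ⟨r, hr, hry⟩ := exists_smul_channel_add_sub_mem hP hy
      rw [diamondNorm, baseSectionNorm, gauge_def] at h
      have hne : r ∈ {r : ℝ | 0 < r ∧ y ∈ r • {y : MatMap A.dim B.dim |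
          ∃ b ∈ Channel P A B, y - -b ∈ coneAlg P A B ∧ b - y ∈ coneAlg P A B}} :=
        ⟨hr, (mem_smul_unitBall_iff hP hr).2 hry⟩
      obtain ⟨s, ⟨hs, hys⟩, hsd⟩ := exists_lt_of_csInf_lt ⟨r, hne⟩ (h.trans_lt hd)
      exact diamondBall_mono hP hsd.le ((mem_smul_unitBall_iff hP hs).1 hys)
    have := (isClosed_radii hP y).closure_subset_iff.2 hsub
    rw [closure_Ioi] at this
    exact this Set.self_mem_Ici
  · intro h
    rcases hc.eq_or_lt with rfl | hc
    · rw [diamondBall_zero hP h, diamondNorm, baseSectionNorm, gauge_zero]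
    · exact gauge_le_of_mem hc.le ((mem_smul_unitBall_iff hP hc).2 h)

/-- The supremum defining the dual norm is therefore finite: `ξ = (β + ξ) - β`, where both terms
range over compact sets. -/
theorem exists_bound_pairing (hP : IsAdmissible P) (Γ : MatMap B.dim A.dim) :
    ∃ c : ℝ, ∀ ξ ∈ diamondBall P A B 1, pairing ξ Γ ≤ c := by
  obtain ⟨M, hM⟩ := ((isCompact_traceLe (A := A) (B := B) hP 2).image
    (continuous_pairing Γ)).bddAbove
  obtain ⟨N, hN⟩ := ((isCompact_channel (A := A) (B := B) hP).image
    (continuous_pairing Γ)).bddBelow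
  refine ⟨M - N, fun ξ ⟨β, hβ, h1, h2⟩ => ?_⟩
  rw [one_smul] at h1 h2
  have h3 : β + ξ ∈ traceLe P A B 2 := ⟨h1, fun a ha => by
    have := (Complex.le_def.1 ((hP.subset_pos _ _ h2.1).2 a ha).trace_nonneg).1
    simp only [LinearMap.sub_apply, LinearMap.add_apply, Matrix.trace_sub, Matrix.trace_add,
      hβ.2, Complex.sub_re, Complex.add_re, Complex.zero_re] at this ⊢
    linarith⟩
  have h4 := hM ⟨_, h3, rfl⟩
  have h5 := hN ⟨_, hβ, rfl⟩
  have h6 : pairing (β + ξ) Γ = pairing β Γ + pairing ξ Γ := map_add (pairingLM Γ) β ξ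
  simp only at h4 h5
  linarith

theorem pairing_le_dualDiamondNorm (hP : IsAdmissible P) {c : ℝ} (hc : 0 ≤ c)
    {ξ : MatMap A.dim B.dim} (hξ : ξ ∈ diamondBall P A B c) (Γ : MatMap B.dim A.dim) :
    pairing ξ Γ ≤ c * dualDiamondNorm P B A Γ := by
  rcases hc.eq_or_lt with rfl | hc
  · rw [diamondBall_zero hP hξ, ← pairingLM_apply, map_zero, zero_mul]
  obtain ⟨M, hM⟩ := exists_bound_pairing hP Γ
  have h1 : c⁻¹ • ξ ∈ diamondBall P A B 1 := by
    simpa [hc.ne'] using smul_mem_diamondBall hP (inv_nonneg.2 hc.le) hξ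
  have h2 : pairing (c⁻¹ • ξ) Γ ≤ dualDiamondNorm P B A Γ := by
    refine le_csSup ⟨M, ?_⟩ ⟨c⁻¹ • ξ, mem_hermAlg_of_mem_diamondBall h1,
      (diamondNorm_le_iff hP zero_le_one (mem_hermAlg_of_mem_diamondBall h1)).2 h1,
      pairing_comm _ _⟩
    rintro _ ⟨ζ, hζ, hζ1, rfl⟩
    rw [pairing_comm]
    exact hM ζ ((diamondNorm_le_iff hP zero_le_one hζ).1 hζ1)
  rw [← pairingLM_apply, map_smul, pairingLM_apply, smul_eq_mul, inv_mul_le_iff₀ hc] at h2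
  exact h2

theorem zero_mem_diamondBall (hP : IsAdmissible P) {c : ℝ} (hc : 0 ≤ c) :
    (0 : MatMap A.dim B.dim) ∈ diamondBall P A B c := by
  obtain ⟨β, hβ⟩ := channel_nonempty hP A B
  have := coneAlg_smul hP hc hβ.1
  exact ⟨β, hβ, by rwa [add_zero], by rwa [sub_zero]⟩

theorem dualDiamondNorm_le (hP : IsAdmissible P) {c : ℝ} {Γ : MatMap B.dim A.dim}
    (h : ∀ ξ ∈ diamondBall P A B 1, pairing ξ Γ ≤ c) : dualDiamondNorm P B A Γ ≤ c := by
  refine csSup_le ⟨_, 0, (hermAlgSubmodule A B).zero_mem, (diamondNorm_le_iff hP zero_le_one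
    (hermAlgSubmodule A B).zero_mem).2 (zero_mem_diamondBall hP zero_le_one), rfl⟩ ?_
  rintro _ ⟨ζ, hζ, hζ1, rfl⟩
  rw [pairing_comm]
  exact h ζ ((diamondNorm_le_iff hP zero_le_one hζ).1 hζ1)

theorem channel_subset_diamondBall (hP : IsAdmissible P) :
    Channel P A B ⊆ diamondBall P A B 1 := fun β hβ =>
  ⟨β, hβ, by rw [one_smul]; exact coneAlg_add hP hβ.1 hβ.1, by
    rw [one_smul, sub_self]; exact zero_mem_coneAlg hP⟩

theorem pairing_channel_le (hP : IsAdmissible P) {β : MatMap A.dim B.dim}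
    (hβ : β ∈ Channel P A B) (Γ : MatMap B.dim A.dim) :
    pairing β Γ ≤ dualDiamondNorm P B A Γ := by
  simpa using pairing_le_dualDiamondNorm hP zero_le_one (channel_subset_diamondBall hP hβ) Γ

/-- On the dual cone, the dual norm is a maximum over channels. -/
theorem exists_channel_dualDiamondNorm_eq (hP : IsAdmissible P) {Γ : MatMap B.dim A.dim}
    (hΓ : Γ ∈ coneAlg (dualFamily P) B A) :
    ∃ β ∈ Channel P A B, dualDiamondNorm P B A Γ = pairing β Γ := by
  obtain ⟨β, hβ, hmax⟩ := (isCompact_channel (A := A) (B := B) hP).exists_isMaxOn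
    (channel_nonempty hP A B) (continuous_pairing Γ).continuousOn
  refine ⟨β, hβ, le_antisymm (dualDiamondNorm_le hP ?_) (pairing_channel_le hP hβ Γ)⟩
  rintro ξ ⟨γ, hγ, -, h⟩
  -- Of the bounds `-γ ≤ ξ ≤ γ` only the upper one matters, as `Γ` is nonnegative on the cone.
  have h1 := hΓ.1.2 _ h.1
  rw [one_smul, ← pairingLM_apply, map_sub, sub_nonneg] at h1
  exact h1.trans (hmax hγ)

/-! ### Dual cones and separation. -/

theorem comp_mem_dualCone (hP : IsAdmissible P) {Γ : MatMap C.dim A.dim}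
    {φ : MatMap A.dim B.dim} (hφ : φ ∈ coneAlg P A B)
    (hΓ : Γ ∈ coneAlg (dualFamily P) C A) : φ ∘ₗ Γ ∈ coneAlg (dualFamily P) C B :=
  ⟨⟨Herm.comp hΓ.1.1 hφ.2.1, fun χ hχ => hΓ.1.2 (χ ∘ₗ φ) (hP.comp_mem _ _ _ _ hφ.1 _ hχ)⟩,
    HermAlg.comp hΓ.2 hφ.2⟩

/-- Testing on `P(A,B)` suffices, because compression by the expectations maps `P(H,K)` into it and
preserves the pairing with `Γ`. -/
theorem mem_dualCone (hP : IsAdmissible P) {Γ : MatMap B.dim A.dim} (hΓ : Γ ∈ HermAlg B A)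
    (h : ∀ φ ∈ coneAlg P A B, 0 ≤ pairing φ Γ) : Γ ∈ coneAlg (dualFamily P) B A := by
  refine ⟨⟨hΓ.1, fun φ hφ => ?_⟩, hΓ⟩
  rw [pairing_comm, ← pairing_compress hΓ, pairing_comm]
  exact h _ (compress_mem_coneAlg hP hφ)

/-- A closed convex set is separated from a point by an element of the dual space. -/
theorem exists_pairing_separation {T : Set (MatMap A.dim B.dim)} (hT : Convex ℝ T)
    (hTc : IsClosed T) (hTA : T ⊆ HermAlg A B) {x : MatMap A.dim B.dim} (hx : x ∈ HermAlg A B)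
    (hxT : x ∉ T) :
    ∃ Γ ∈ HermAlg B A, ∃ u : ℝ, (∀ z ∈ T, pairing z Γ < u) ∧ u < pairing x Γ := by
  obtain ⟨f, u, hf, hu⟩ := geometric_hahn_banach_closed_point hT hTc hxT
  obtain ⟨Γ, hΓ, h⟩ := exists_pairing_eq (f : MatMap A.dim B.dim →ₗ[ℝ] ℝ)
  have h' : ∀ z ∈ HermAlg A B, pairing z (A.condExp ∘ₗ Γ ∘ₗ B.condExp) = f z := fun z hz => by
    rw [pairing_compress hz, h z hz.1]
    rfl
  exact ⟨_, compress_mem_hermAlg hΓ, u, fun z hz => by rw [h' z (hTA hz)]; exact hf z hz,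
    by rw [h' x hx]; exact hu⟩

end norms

/-! ### Deficiency -/

section deficiency

variable {P : Family} {A B B' D : CAlg} {Φ : MatMap A.dim B.dim} {Ψ : MatMap A.dim B'.dim} {ε : ℝ}

/-- The maps `α' ∘ Ψ` with channels `α'`. -/
def postProcessings (P : Family) {A B' : CAlg} (D : CAlg) (Ψ : MatMap A.dim B'.dim) :
    Set (MatMap A.dim D.dim) :=
  (fun α' : MatMap B'.dim D.dim => α' ∘ₗ Ψ) '' Channel P B' D

theorem convex_postProcessings (hP : IsAdmissible P) : Convex ℝ (postProcessings P D Ψ) := by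
  rintro _ ⟨x, hx, rfl⟩ _ ⟨y, hy, rfl⟩ a b ha hb hab
  exact ⟨a • x + b • y, convex_channel hP hx hy ha hb hab, rfl⟩

theorem isCompact_postProcessings (hP : IsAdmissible P) : IsCompact (postProcessings P D Ψ) :=
  (isCompact_channel hP).image (continuous_comp_right Ψ)

/-- `Φ ∘ Γ` and `Ψ ∘ Γ` stay in the dual cone, so both norms are attained at channels, which serve
as `α` and `α'`. -/
theorem deficientOn_iff_dualDiamondNorm_le (hP : IsAdmissible P) (hΦ : Φ ∈ Channel P A B)
    (hΨ : Ψ ∈ Channel P A B') :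
    DeficientOn P ε D Ψ Φ ↔ ∀ Γ ∈ coneAlg (dualFamily P) D A,
      dualDiamondNorm P D B (Φ ∘ₗ Γ) ≤
        dualDiamondNorm P D B' (Ψ ∘ₗ Γ) + ε * dualDiamondNorm P D A Γ := by
  refine forall₂_congr fun Γ hΓ => ⟨fun h => ?_, fun h α hα => ?_⟩
  · obtain ⟨α, hα, hαe⟩ := exists_channel_dualDiamondNorm_eq hP (comp_mem_dualCone hP hΦ.1 hΓ)
    obtain ⟨α', hα', hle⟩ := h α hα
    have := pairing_channel_le hP hα' (Ψ ∘ₗ Γ)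
    rw [pairing_comp_left, pairing_comp_left] at hle
    linarith
  · obtain ⟨α', hα', hαe⟩ := exists_channel_dualDiamondNorm_eq hP (comp_mem_dualCone hP hΨ.1 hΓ)
    refine ⟨α', hα', ?_⟩
    have := pairing_channel_le hP hα (Φ ∘ₗ Γ)
    rw [pairing_comp_left, pairing_comp_left]
    linarith

theorem sub_mem_hermAlg {φ ψ : MatMap A.dim B.dim} (hφ : φ ∈ HermAlg A B)
    (hψ : ψ ∈ HermAlg A B) : φ - ψ ∈ HermAlg A B :=
  (hermAlgSubmodule A B).sub_mem hφ hψ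

/-- A deficient `Ψ` dominates `α ∘ Φ` up to `ε` times a channel. -/
theorem DeficientOn.exists_le (hP : IsAdmissible P) (hΦ : Φ ∈ Channel P A B)
    (hΨ : Ψ ∈ Channel P A B') (h : DeficientOn P ε D Ψ Φ)
    {α : MatMap B.dim D.dim} (hα : α ∈ Channel P B D) :
    ∃ α' ∈ Channel P B' D, ∃ β ∈ Channel P A D,
      α' ∘ₗ Ψ + ε • β - α ∘ₗ Φ ∈ coneAlg P A D := by
  let T : Set (MatMap A.dim D.dim) :=
    -coneAlg P A D + (postProcessings P D Ψ + ε • Channel P A D)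
  have hT : Convex ℝ T :=
    (convex_coneAlg hP).neg.add ((convex_postProcessings hP).add ((convex_channel hP).smul ε))
  have hTc : IsClosed T := (isClosed_coneAlg hP).neg.add_right_of_isCompact
    ((isCompact_postProcessings hP).add ((isCompact_channel hP).smul ε))
  have hmem : ∀ φ ∈ coneAlg P A D, ∀ α' ∈ Channel P B' D, ∀ β ∈ Channel P A D,
      -φ + (α' ∘ₗ Ψ + ε • β) ∈ T := fun φ hφ α' hα' β hβ =>
    Set.add_mem_add (Set.neg_mem_neg.2 hφ)
      (Set.add_mem_add ⟨α', hα', rfl⟩ (Set.smul_mem_smul_set hβ))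
  have hTA : T ⊆ HermAlg A D := by
    rintro _ ⟨φ, hφ, _, ⟨_, ⟨α', hα', rfl⟩, _, ⟨β, hβ, rfl⟩, rfl⟩, rfl⟩
    refine (hermAlgSubmodule A D).add_mem ?_ ((hermAlgSubmodule A D).add_mem
      (HermAlg.comp hΨ.1.2 hα'.1.2) ((hermAlgSubmodule A D).smul_mem ε hβ.1.2))
    have := (hermAlgSubmodule A D).neg_mem hφ.2
    rwa [neg_neg] at this
  have hxT : α ∘ₗ Φ ∈ T := by
    by_contra hxT
    obtain ⟨Γ, hΓ, u, hu, hux⟩ :=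
      exists_pairing_separation hT hTc hTA (HermAlg.comp hΦ.1.2 hα.1.2) hxT
    have hu' : ∀ φ ∈ coneAlg P A D, ∀ α' ∈ Channel P B' D, ∀ β ∈ Channel P A D,
        -pairing φ Γ + (pairing (α' ∘ₗ Ψ) Γ + ε * pairing β Γ) < u :=
      fun φ hφ α' hα' β hβ => by
        simpa only [← pairingLM_apply, map_add, map_neg, map_smul, smul_eq_mul] using
          hu _ (hmem φ hφ α' hα' β hβ)
    -- `T` is stable under subtracting cone elements, so a negative value of `Γ` on the cone would
    -- make it unbounded above on `T`.
    have hΓ' : Γ ∈ coneAlg (dualFamily P) D A := by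
      refine mem_dualCone hP hΓ fun φ hφ => ?_
      obtain ⟨α', hα'⟩ := channel_nonempty hP B' D
      obtain ⟨β, hβ⟩ := channel_nonempty hP A D
      by_contra! hneg
      obtain ⟨t, ht⟩ := exists_nat_gt
        ((u - (pairing (α' ∘ₗ Ψ) Γ + ε * pairing β Γ)) / (-pairing φ Γ))
      rw [div_lt_iff₀ (by linarith)] at ht
      have := hu' _ (coneAlg_smul hP (Nat.cast_nonneg t) hφ) α' hα' β hβ
      rw [← pairingLM_apply, map_smul, pairingLM_apply, smul_eq_mul] at this
      linarith
    -- With `β` attaining the dual norm of `Γ`, the point `α' ∘ Ψ + ε • β` of `T` violates the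
    -- separation.
    obtain ⟨β, hβ, hβe⟩ := exists_channel_dualDiamondNorm_eq hP hΓ'
    obtain ⟨α', hα', hle⟩ := h Γ hΓ' α hα
    have h0 := hu' 0 (zero_mem_coneAlg hP) α' hα' β hβ
    rw [← pairingLM_apply Γ 0, map_zero] at h0
    rw [hβe] at hle
    linarith
  obtain ⟨φ, hφ, _, ⟨_, ⟨α', hα', rfl⟩, _, ⟨β, hβ, rfl⟩, rfl⟩, hsum⟩ := hxT
  refine ⟨α', hα', β, hβ, ?_⟩
  have hφ' : α' ∘ₗ Ψ + ε • β - α ∘ₗ Φ = -φ := by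
    rw [← hsum]
    simp only
    abel
  rw [hφ']
  exact hφ

theorem DeficientOn.exists_sub_mem_diamondBall (hP : IsAdmissible P) (hΦ : Φ ∈ Channel P A B)
    (hΨ : Ψ ∈ Channel P A B') (hε : 0 ≤ ε) (h : DeficientOn P ε D Ψ Φ)
    {α : MatMap B.dim D.dim} (hα : α ∈ Channel P B D) :
    ∃ α' ∈ Channel P B' D, α ∘ₗ Φ - α' ∘ₗ Ψ ∈ diamondBall P A D (2 * ε) := by
  obtain ⟨α', hα', β, hβ, hm⟩ := h.exists_le hP hΦ hΨ hα
  obtain ⟨γ, hγ, he⟩ := exists_channel_eq_smul hP hm hε fun a => by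
    have h1 := (channel_comp hP hΨ hα').2 a
    have h2 := (channel_comp hP hΦ hα).2 a
    rw [LinearMap.sub_apply, LinearMap.add_apply, Matrix.trace_sub, Matrix.trace_add, h1, h2,
      LinearMap.smul_apply, Matrix.trace_smul, hβ.2, Complex.real_smul]
    ring
  have hy : α ∘ₗ Φ - α' ∘ₗ Ψ = ε • β - ε • γ := by
    rw [← he]
    abel
  -- The midpoint of `β` and `γ` dominates: `ε • (β + γ) ± ε • (β - γ)` equals `(2 * ε) • β` or `(2
  -- * ε) • γ`.
  refine ⟨α', hα', (1 / 2 : ℝ) • β + (1 / 2 : ℝ) • γ,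
    convex_channel hP hβ hγ (by norm_num) (by norm_num) (by norm_num), ?_, ?_⟩
  · convert coneAlg_smul hP (mul_nonneg zero_le_two hε) hβ.1 using 1
    rw [hy]
    module
  · convert coneAlg_smul hP (mul_nonneg zero_le_two hε) hγ.1 using 1
    rw [hy]
    module

/-- The difference of two channels is, up to half of its norm, at most a channel. -/
theorem pairing_sub_channel_le (hP : IsAdmissible P) (hε : 0 ≤ ε) {φ ψ : MatMap A.dim D.dim}
    (hφ : φ ∈ Channel P A D) (hψ : ψ ∈ Channel P A D)
    (h : φ - ψ ∈ diamondBall P A D (2 * ε)) {Γ : MatMap D.dim A.dim}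
    (hΓ : Γ ∈ coneAlg (dualFamily P) D A) :
    pairing φ Γ ≤ pairing ψ Γ + ε * dualDiamondNorm P D A Γ := by
  obtain ⟨β, hβ, h1, h2⟩ := h
  have h3 := coneAlg_smul hP (c := 1 / 2) (by norm_num) h1
  -- `φ - ψ` annihilates the trace, so half of `(2 * ε) • β + (φ - ψ)` multiplies it by `ε`; this
  -- removes the factor 2.
  obtain ⟨γ, hγ, he⟩ := exists_channel_eq_smul hP h3 hε fun a => by
    simp [hφ.2, hψ.2, hβ.2]
    ring
  have h4 : φ - ψ + (1 / 2 : ℝ) • ((2 * ε) • β - (φ - ψ)) = ε • γ := by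
    rw [← he]
    module
  have h5 : 0 ≤ pairing ((1 / 2 : ℝ) • ((2 * ε) • β - (φ - ψ))) Γ :=
    hΓ.1.2 _ (coneAlg_smul hP (by norm_num) h2).1
  have h6 := congrArg (pairingLM Γ) h4
  rw [map_add, map_sub, map_smul (pairingLM Γ) ε γ, smul_eq_mul] at h6
  simp only [pairingLM_apply] at h6
  have h7 := mul_le_mul_of_nonneg_left (pairing_channel_le hP hγ Γ) hε
  linarith

/-- This makes `α'` independent of `Γ`: a functional separating `α ∘ Φ` from ball plus
post-processings would contradict `h`, since its supremum over the ball is `c` times its dual norm.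
-/
theorem exists_sub_mem_diamondBall_of_pairing_le (hP : IsAdmissible P) {c : ℝ} (hc : 0 ≤ c)
    (hΦ : Φ ∈ Channel P A B) (hΨ : Ψ ∈ Channel P A B')
    {α : MatMap B.dim D.dim} (hα : α ∈ Channel P B D)
    (h : ∀ Γ ∈ HermAlg D A, ∃ α' ∈ Channel P B' D,
      pairing (α ∘ₗ Φ) Γ ≤ pairing (α' ∘ₗ Ψ) Γ + c * dualDiamondNorm P D A Γ) :
    ∃ α' ∈ Channel P B' D, α ∘ₗ Φ - α' ∘ₗ Ψ ∈ diamondBall P A D c := by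
  let T : Set (MatMap A.dim D.dim) := diamondBall P A D c + postProcessings P D Ψ
  have hT : Convex ℝ T := (convex_diamondBall hP c).add (convex_postProcessings hP)
  have hTc : IsClosed T :=
    (isClosed_diamondBall hP c).add_right_of_isCompact (isCompact_postProcessings hP)
  have hTA : T ⊆ HermAlg A D := by
    rintro _ ⟨y, hy, _, ⟨α', hα', rfl⟩, rfl⟩
    exact (hermAlgSubmodule A D).add_mem (mem_hermAlg_of_mem_diamondBall hy)
      (HermAlg.comp hΨ.1.2 hα'.1.2)
  have hxT : α ∘ₗ Φ ∈ T := by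
    by_contra hxT
    obtain ⟨Γ, hΓ, u, hu, hux⟩ :=
      exists_pairing_separation hT hTc hTA (HermAlg.comp hΦ.1.2 hα.1.2) hxT
    obtain ⟨α', hα', hle⟩ := h Γ hΓ
    have hball : ∀ y ∈ diamondBall P A D c, pairing y Γ < u - pairing (α' ∘ₗ Ψ) Γ :=
      fun y hy => by
        have := hu _ (Set.add_mem_add hy ⟨α', hα', rfl⟩)
        rw [← pairingLM_apply, map_add] at this
        exact lt_sub_iff_add_lt.2 this
    have hn : c * dualDiamondNorm P D A Γ ≤ u - pairing (α' ∘ₗ Ψ) Γ := by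
      rcases hc.eq_or_lt with rfl | hc
      · have := hball 0 (zero_mem_diamondBall hP le_rfl)
        rw [← pairingLM_apply, map_zero] at this
        rw [zero_mul]
        exact this.le
      · rw [← le_div_iff₀' hc]
        refine dualDiamondNorm_le hP fun ξ hξ => ?_
        have := hball (c • ξ) (by simpa using smul_mem_diamondBall hP hc.le hξ)
        rw [← pairingLM_apply, map_smul, pairingLM_apply, smul_eq_mul] at this
        rw [le_div_iff₀' hc]
        exact this.le
    linarith
  obtain ⟨y, hy, _, ⟨α', hα', rfl⟩, hsum⟩ := hxT
  refine ⟨α', hα', ?_⟩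
  rw [← hsum]
  simpa using hy

theorem comp_mem_diamondBall (hP : IsAdmissible P) {c : ℝ} {y : MatMap A.dim B.dim}
    (hy : y ∈ diamondBall P A B c) {α : MatMap B.dim D.dim} (hα : α ∈ Channel P B D) :
    α ∘ₗ y ∈ diamondBall P A D c := by
  obtain ⟨β, hβ, h1, h2⟩ := hy
  have hs : α ∘ₗ (c • β) = c • (α ∘ₗ β) := by
    ext1 a
    exact (α.restrictScalars ℝ).map_smul c (β a)
  refine ⟨α ∘ₗ β, channel_comp hP hβ hα, ?_, ?_⟩
  · rw [← hs, ← LinearMap.comp_add]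
    exact coneAlg_comp hP h1 hα.1
  · rw [← hs, ← LinearMap.comp_sub]
    exact coneAlg_comp hP h2 hα.1

/-- The expectation is the identity of `L(B,B)`, namely the compression of the identity map. -/
theorem condExp_mem_channel (hP : IsAdmissible P)
    (hid : ∀ n : ℕ, (LinearMap.id : MatMap n n) ∈ P n n) (B : CAlg) :
    B.condExp ∈ Channel P B B := by
  refine ⟨?_, B.trace_condExp⟩
  have := compress_mem_coneAlg (A := B) (B := B) hP (hid B.dim)
  rwa [LinearMap.id_comp, B.condExp_comp_condExp] at this

end deficiency

end PostProcessing

/-! ### Assembly of the equivalences. -/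

open PostProcessing
theorem mainTheorem1 (P : Family) (hP : IsAdmissible P) (A B B' : CAlg)
    (Φ : MatMap A.dim B.dim) (hΦ : Φ ∈ Channel P A B)
    (Ψ : MatMap A.dim B'.dim) (hΨ : Ψ ∈ Channel P A B')
    (ε : ℝ) (hε : 0 ≤ ε) :
    (∀ D : CAlg, List.TFAE
      [DeficientOn P ε D Ψ Φ,
       ∀ Γ ∈ coneAlg (dualFamily P) D A,
         dualDiamondNorm P D B (Φ ∘ₗ Γ) ≤
           dualDiamondNorm P D B' (Ψ ∘ₗ Γ) + ε * dualDiamondNorm P D A Γ,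
       ∀ Γ ∈ HermAlg D A, ∀ α ∈ Channel P B D, ∃ α' ∈ Channel P B' D,
         pairing (α ∘ₗ Φ) Γ ≤ pairing (α' ∘ₗ Ψ) Γ + 2 * ε * dualDiamondNorm P D A Γ,
       ∀ α ∈ Channel P B D, ∃ α' ∈ Channel P B' D,
         diamondNorm P A D (α ∘ₗ Φ - α' ∘ₗ Ψ) ≤ 2 * ε]) ∧
    ((∀ n : ℕ, (LinearMap.id : MatMap n n) ∈ P n n) →
      (Deficient P ε Ψ Φ ↔ DeficientOn P ε B Ψ Φ)) := by
  have hε2 : 0 ≤ 2 * ε := by positivity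
  have hnorm : ∀ {D : CAlg} {α : MatMap B.dim D.dim} {α' : MatMap B'.dim D.dim},
      α ∈ Channel P B D → α' ∈ Channel P B' D →
      (diamondNorm P A D (α ∘ₗ Φ - α' ∘ₗ Ψ) ≤ 2 * ε ↔
        α ∘ₗ Φ - α' ∘ₗ Ψ ∈ diamondBall P A D (2 * ε)) := fun hα hα' =>
    diamondNorm_le_iff hP hε2
      (sub_mem_hermAlg (HermAlg.comp hΦ.1.2 hα.1.2) (HermAlg.comp hΨ.1.2 hα'.1.2))
  have hdef : ∀ D : CAlg, (∀ α ∈ Channel P B D, ∃ α' ∈ Channel P B' D,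
      α ∘ₗ Φ - α' ∘ₗ Ψ ∈ diamondBall P A D (2 * ε)) → DeficientOn P ε D Ψ Φ := by
    intro D h Γ hΓ α hα
    obtain ⟨α', hα', hb⟩ := h α hα
    exact ⟨α', hα', pairing_sub_channel_le hP hε (channel_comp hP hΦ hα)
      (channel_comp hP hΨ hα') hb hΓ⟩
  refine ⟨fun D => ?_, fun hid => ⟨fun h => h B, fun h D => hdef D fun α hα => ?_⟩⟩
  · tfae_have 1 ↔ 2 := deficientOn_iff_dualDiamondNorm_le hP hΦ hΨ
    tfae_have 1 → 4 := fun h α hα => by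
      obtain ⟨α', hα', hb⟩ := h.exists_sub_mem_diamondBall hP hΦ hΨ hε hα
      exact ⟨α', hα', (hnorm hα hα').2 hb⟩
    tfae_have 4 → 1 := fun h => hdef D fun α hα => by
      obtain ⟨α', hα', hn⟩ := h α hα
      exact ⟨α', hα', (hnorm hα hα').1 hn⟩
    tfae_have 4 → 3 := fun h Γ _ α hα => by
      obtain ⟨α', hα', hn⟩ := h α hα
      have := pairing_le_dualDiamondNorm hP hε2 ((hnorm hα hα').1 hn) Γ
      rw [← pairingLM_apply, map_sub] at this
      exact ⟨α', hα', sub_le_iff_le_add'.1 this⟩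
    tfae_have 3 → 4 := fun h α hα => by
      obtain ⟨α', hα', hb⟩ := exists_sub_mem_diamondBall_of_pairing_le hP hε2 hΦ hΨ hα
        fun Γ hΓ => h Γ hΓ α hα
      exact ⟨α', hα', (hnorm hα hα').2 hb⟩
    tfae_finish
  -- Since `E_B ∘ Φ = Φ`, this single `α'` approximates `Φ`, and `α ∘ α'` works for every `D` and
  -- `α`.
  · obtain ⟨α', hα', hb⟩ := h.exists_sub_mem_diamondBall hP hΦ hΨ hε
      (condExp_mem_channel hP hid B)
    refine ⟨α ∘ₗ α', channel_comp hP hα' hα, ?_⟩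
    have := comp_mem_diamondBall hP hb hα
    rwa [(mem_hermAlg_iff.1 hΦ.1.2).2.1, LinearMap.comp_sub, ← LinearMap.comp_assoc] at this
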